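/- For a word $w=w_1\cdots w_p$ of distinct letters let $\mathrm{des}(w)=|\{i<p: w_i>w_{i+1}\}|$ and let $\mathrm{red}(w)$ be the word obtained by replacing the $i$-th smallest letter of $w$ by $i$. Write each cycle of a permutation $\sigma\in S_n$ (fixed points included) as $C=(c_0,\dots,c_{p-1})$ with $c_0$ its smallest element, and put $\mathrm{cdes}(C)=1+\mathrm{des}(c_0\cdots c_{p-1})$. Let $\mathrm{cyc}(\sigma)$ be the number of cycles of $\sigma$ and $\mathrm{cdes}(\sigma)=\sum_C \mathrm{cdes}(C)$ the sum over its cycles. For $\tau=\tau_1\cdots\tau_j\in S_j$, $\sigma$ has a cycle $\tau$-match if it has a cycle $(c_0,\dots,c_{p-1})$ of length $p\ge j$ and an $r$ with $\mathrm{red}(c_r c_{r+1}\cdots c_{r+j-1})=\tau$, indices taken modulo $p$. Let $\mathcal{NCMS}_n(\tau)$ be the set of $\sigma\in S_n$ without cycle $\tau$-matches, and let $$NCM_\tau(t,x,y)=1+\sum_{n\ge1}\frac{t^n}{n!}\sum_{\sigma\in\mathcal{NCMS}_n(\tau)}x^{\mathrm{cyc}(\sigma)}y^{\mathrm{cdes}(\sigma)}.$$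 **Theorem.** Let $j\ge3$ and let $\tau=\tau_1\cdots\tau_j\in S_j$ satisfy $\tau_1=1$ and $\tau_j=2$. Then $$NCM_\tau(t,x,y)=\frac{1}{\left(1-y\int_0^t \exp\left((1-y)s-\frac{y^{\mathrm{des}(\tau)}s^{j-1}}{(j-1)!}\right)ds\right)^x}$$ as formal power series in $t$. Here $x,y$ are indeterminates over $\mathbb{Q}$ or, more generally, arbitrary elements of a commutative $\mathbb{Q}$-algebra $R$; integration and $\exp$ are formal, and $U^x=\exp(x\log U)$ for a power series $U\in R[[t]]$ with constant term $1$. -/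

import Mathlib

namespace CyclePattern

noncomputable section

/-!
Permutations of `{1, …, n}` are elements of `Equiv.Perm (Fin n)`; all values and positions are
shifted down by one. The one-line notation of `τ` is the word `fun i => τ i`.
-/

/-- The number of descents of a word `w_0 w_1 ⋯ w_{p-1}`, i.e. of positions `i` with
`w_i > w_{i+1}`. -/
def des {p : ℕ} {α : Type*} [LinearOrder α] (w : Fin p → α) : ℕ :=
  (Finset.univ.filter fun i : Fin p =>
    ∃ h : (i : ℕ) + 1 < p, w ⟨(i : ℕ) + 1, h⟩ < w i).card

/-- The reduction of a word with distinct letters: its `i`-th smallest letter is replaced by `i`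
(by `i - 1` in the zero-based convention, so a letter becomes the number of smaller letters). -/
def red {p : ℕ} {α : Type*} [LinearOrder α] (w : Fin p → α) : Fin p → ℕ :=
  fun i => (Finset.univ.filter fun k : Fin p => w k < w i).card

open Classical in
/-- The smallest elements of the cycles of `σ` (fixed points are cycles of length one). Each cycle
has exactly one, so this set indexes the cycles of `σ`. -/
def cycleMinima {n : ℕ} (σ : Equiv.Perm (Fin n)) : Finset (Fin n) :=
  Finset.univ.filter fun c => ∀ b, σ.SameCycle c b → c ≤ b

/-- The length of the cycle of `σ` that contains `c`. -/
def cycleLength {n : ℕ} (σ : Equiv.Perm (Fin n)) (c : Fin n) : ℕ :=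
  Function.minimalPeriod σ c

/-- The cycle of `σ` through `c`, written `(c, σ c, σ² c, …)`. -/
def cycleWord {n : ℕ} (σ : Equiv.Perm (Fin n)) (c : Fin n) : Fin (cycleLength σ c) → Fin n :=
  fun i => (σ ^ (i : ℕ)) c

/-- The number of cycles of `σ`, fixed points included. -/
def cyc {n : ℕ} (σ : Equiv.Perm (Fin n)) : ℕ :=
  (cycleMinima σ).card

/-- The number of cycle descents: each cycle `C = (c_0, …, c_{p-1})`, written with its smallest
element `c_0` first, contributes `1 + des (c_0 ⋯ c_{p-1})`. -/
def cdes {n : ℕ} (σ : Equiv.Perm (Fin n)) : ℕ :=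
  ∑ c ∈ cycleMinima σ, (1 + des (cycleWord σ c))

/-- `σ` has a cycle `τ`-match: some cycle `(c_0, …, c_{p-1})` of length `p ≥ j` and some `r < p`
satisfy `red (c_r c_{r+1} ⋯ c_{r+j-1}) = τ`, indices modulo `p`.
Here `(σ ^ m) c_0 = c_{m mod p}`. -/
def HasCycleMatch {j n : ℕ} (τ : Equiv.Perm (Fin j)) (σ : Equiv.Perm (Fin n)) : Prop :=
  ∃ c ∈ cycleMinima σ, j ≤ cycleLength σ c ∧ ∃ r < cycleLength σ c,
    red (fun i : Fin j => (σ ^ (r + (i : ℕ))) c) = fun i => (τ i : ℕ)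

open Classical in
/-- The permutations of an `n`-element set without cycle `τ`-matches. -/
def noCycleMatch {j : ℕ} (τ : Equiv.Perm (Fin j)) (n : ℕ) : Finset (Equiv.Perm (Fin n)) :=
  Finset.univ.filter fun σ => ¬ HasCycleMatch τ σ

section Series

variable {R : Type*} [CommRing R] [Algebra ℚ R]

/-- The generating function
`NCM_τ(t, x, y) = ∑_n (t^n / n!) ∑_σ x^{cyc σ} y^{cdes σ}`, a power series in `t`, where `σ` runs
over the permutations of `{1, …, n}` without cycle `τ`-matches (the term for `n = 0` is `1`). -/
def NCM {j : ℕ} (τ : Equiv.Perm (Fin j)) (x y : R) : PowerSeries R :=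
  PowerSeries.mk fun n =>
    ((n.factorial : ℚ)⁻¹) • ∑ σ ∈ noCycleMatch τ n, x ^ cyc σ * y ^ cdes σ

/-- The formal integral `∫_0^t f(s) ds`. -/
def integral (f : PowerSeries R) : PowerSeries R :=
  PowerSeries.mk fun n => if n = 0 then 0 else ((n : ℚ)⁻¹) • PowerSeries.coeff (n - 1) f

/-- `exp (f)` for a power series `f` with zero constant term. -/
def expOf (f : PowerSeries R) : PowerSeries R :=
  (PowerSeries.exp R).subst f

/-- The power `f ^ a = exp (a * log f)` for a power series `f` with constant term `1`. -/
def powOf (f : PowerSeries R) (a : R) : PowerSeries R :=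
  expOf (PowerSeries.C a * PowerSeries.logOf f)

/-- `1 - y ∫_0^t exp ((1 - y) s - y^d s^{j-1} / (j-1)!) ds`. -/
def denominator (j d : ℕ) (y : R) : PowerSeries R :=
  1 - PowerSeries.C y * integral (expOf
    (PowerSeries.C (1 - y) * PowerSeries.X
      - (((j - 1).factorial : ℚ)⁻¹) • (PowerSeries.C (y ^ d) * PowerSeries.X ^ (j - 1))))

end Series

end

end CyclePattern

/-! Let `D` be the denominator, `E` the exponent in its integrand, and `W = -D'/D = y exp(E)/D`.
Then `(D^(-x))' = x W D^(-x)` and `W' = (W + E') W`, where `E' = (1-y) - y^(des τ) t^(j-2)/(j-2)!`.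
Comparing coefficients of `t^n/n!` turns both equations into binomial recursions. The proof shows
that weighted permutations and weighted words obey these recursions with the same initial values.

For permutations, split off the cycle through the smallest element (`permSum_insert`); this is the
recursion for `D^(-x)`, once the cycles on `n+1` given letters have total weight `x` times the
`n`-th coefficient of `W`. Since `τ` starts with its smallest letter, no match wraps around past the
minimum of a cycle (`hasCycleMatch_iff`), so a cycle may be treated as a linear word that starts
with its minimum `m₀`.

For words `m₀ l`, split `l = u m v` at its smallest letter `m`. A match that meets both sides of the
cut before `m` must be exactly `m₀ u m`, because the two smallest letters of `τ` are at its ends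
(`avoids_append_cons_iff`). So the weight is that of `m₀ u` times that of `m v`, with two
corrections: `1 - y` for empty `u`, where no descent into `m` arises, and `-y^(des τ)` for the
single arrangement `u` of each `(j-2)`-set that makes `m₀ u m` a match (`existsUnique_match`). These
corrections are the two terms of `E'`. -/

namespace CyclePattern
noncomputable section

open PowerSeries
open scoped Nat

/-! ### Formal exponentials, powers, and the differential equations of the two series. -/

section PowerSeriesIdentities

variable {R : Type*} [CommRing R]

/-- The coefficient of `t ^ n / n!` in a power series. -/
def egfCoeff (n : ℕ) (F : PowerSeries R) : R :=
  (n ! : R) * coeff n F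

theorem egfCoeff_succ (n : ℕ) (F : PowerSeries R) :
    egfCoeff (n + 1) F = egfCoeff n (d⁄dX R F) := by
  simp only [egfCoeff, coeff_derivative, Nat.factorial_succ, Nat.cast_mul]
  push_cast
  ring

theorem egfCoeff_mul (n : ℕ) (F G : PowerSeries R) :
    egfCoeff n (F * G) =
      ∑ k ∈ Finset.range (n + 1), n.choose k • (egfCoeff k F * egfCoeff (n - k) G) := by
  rw [egfCoeff, coeff_mul, Finset.Nat.sum_antidiagonal_eq_sum_range_succ_mk, Finset.mul_sum]
  refine Finset.sum_congr rfl fun k hk => ?_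
  have h := Nat.choose_mul_factorial_mul_factorial (Nat.lt_succ_iff.mp (Finset.mem_range.mp hk))
  rw [← h, nsmul_eq_mul, egfCoeff, egfCoeff]
  push_cast
  ring

theorem hasSubst_of_constantCoeff {f : PowerSeries R} (hf : constantCoeff f = 0) : HasSubst f :=
  HasSubst.of_constantCoeff_zero' hf

variable [Algebra ℚ R]

theorem constantCoeff_expOf {f : PowerSeries R} (hf : constantCoeff f = 0) :
    constantCoeff (expOf f) = 1 := by
  have h : constantCoeff ((exp R - 1).subst f) = 0 :=
    constantCoeff_subst_eq_zero hf _ (by simp)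
  have h1 : (exp R).subst f = (exp R - 1).subst f + 1 := by
    have := subst_add (hasSubst_of_constantCoeff hf) (exp R - 1) (1 : PowerSeries R)
    rw [sub_add_cancel] at this
    rw [this, ← coe_substAlgHom (hasSubst_of_constantCoeff hf), map_one]
  have h2 : expOf f = (exp R - 1).subst f + 1 := h1
  rw [h2, map_add, h, map_one, zero_add]

theorem derivative_expOf {f : PowerSeries R} (hf : constantCoeff f = 0) :
    d⁄dX R (expOf f) = expOf f * d⁄dX R f := by
  rw [expOf, derivative_subst (hasSubst_of_constantCoeff hf), derivative_exp]

theorem expOf_neg_mul {f : PowerSeries R} (hf : constantCoeff f = 0) :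
    expOf (-f) * expOf f = 1 := by
  -- Without torsion, a power series is determined by its derivative and its constant term.
  have : IsAddTorsionFree R := IsAddTorsionFree.of_module_rat R
  have hf' : constantCoeff (-f) = 0 := by simp [hf]
  refine derivative.ext ?_ ?_
  · rw [Derivation.leibniz, derivative_expOf hf, derivative_expOf hf']
    simp only [map_neg, smul_eq_mul, derivative_one]
    ring
  · rw [map_mul, constantCoeff_expOf hf, constantCoeff_expOf hf', map_one, one_mul]

theorem derivative_integral (f : PowerSeries R) : d⁄dX R (integral f) = f := by
  ext n
  rw [coeff_derivative, integral, coeff_mk, if_neg n.succ_ne_zero, Nat.add_sub_cancel,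
    Algebra.smul_def]
  have h : ((n : R) + 1) = algebraMap ℚ R ((n + 1 : ℕ) : ℚ) := by simp
  rw [h, mul_right_comm, ← map_mul, inv_mul_cancel₀ (by positivity), map_one, one_mul]

theorem constantCoeff_integral (f : PowerSeries R) : constantCoeff (integral f) = 0 := by
  rw [← coeff_zero_eq_constantCoeff_apply, integral, coeff_mk, if_pos rfl]

theorem mul_derivative_logOf {U : PowerSeries R} (hU : constantCoeff U = 1) :
    U * d⁄dX R (logOf U) = d⁄dX R U := by
  have h0 : constantCoeff (U - 1) = 0 := by simp [hU]
  have hs := hasSubst_of_constantCoeff h0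
  -- Substituting `U - 1` for `X` in this identity gives the logarithmic derivative of `U`.
  have key : (1 + X) * d⁄dX R (log R) = 1 := by
    rw [deriv_log]
    ext n
    cases n with
    | zero => simp
    | succ n => simp [add_mul, coeff_succ_X_mul, pow_succ, coeff_one]
  have := congrArg (substAlgHom hs) key
  rw [map_mul, map_add, map_one, substAlgHom_X] at this
  rw [logOf_eq, derivative_subst hs, ← coe_substAlgHom hs, ← mul_assoc]
  rw [add_sub_cancel] at this
  rw [this, one_mul, map_sub, derivative_one, sub_zero]

theorem constantCoeff_mul_logOf {U : PowerSeries R} (hU : constantCoeff U = 1) (a : R) :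
    constantCoeff (C a * logOf U) = 0 := by
  rw [map_mul, constantCoeff_logOf hU, mul_zero]

theorem powOf_neg_mul {U : PowerSeries R} (hU : constantCoeff U = 1) (a : R) :
    powOf U (-a) * powOf U a = 1 := by
  rw [powOf, powOf, map_neg, neg_mul]
  exact expOf_neg_mul (constantCoeff_mul_logOf hU a)

theorem constantCoeff_powOf {U : PowerSeries R} (hU : constantCoeff U = 1) (a : R) :
    constantCoeff (powOf U a) = 1 :=
  constantCoeff_expOf (constantCoeff_mul_logOf hU a)

theorem mul_derivative_powOf {U : PowerSeries R} (hU : constantCoeff U = 1) (a : R) :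
    U * d⁄dX R (powOf U a) = C a * d⁄dX R U * powOf U a := by
  rw [powOf, derivative_expOf (constantCoeff_mul_logOf hU a), Derivation.leibniz,
    derivative_C, smul_zero, add_zero, smul_eq_mul, ← mul_derivative_logOf hU]
  ring

/-- The exponent in the integrand of the denominator. -/
def exponent (j d : ℕ) (y : R) : PowerSeries R :=
  C (1 - y) * X - (((j - 1).factorial : ℚ)⁻¹) • (C (y ^ d) * X ^ (j - 1))

theorem denominator_eq (j d : ℕ) (y : R) :
    denominator j d y = 1 - C y * integral (expOf (exponent j d y)) := rfl

theorem constantCoeff_denominator (j d : ℕ) (y : R) :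
    constantCoeff (denominator j d y) = 1 := by
  rw [denominator_eq, map_sub, map_one, map_mul, constantCoeff_integral, mul_zero, sub_zero]

theorem constantCoeff_exponent {j : ℕ} (hj : 2 ≤ j) (d : ℕ) (y : R) :
    constantCoeff (exponent j d y) = 0 := by
  have : j - 1 ≠ 0 := by omega
  rw [← coeff_zero_eq_constantCoeff_apply]
  simp [exponent, this]

theorem derivative_exponent {j : ℕ} (hj : 2 ≤ j) (d : ℕ) (y : R) :
    d⁄dX R (exponent j d y) =
      C (1 - y) - (((j - 2).factorial : ℚ)⁻¹) • (C (y ^ d) * X ^ (j - 2)) := by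
  obtain ⟨k, rfl⟩ := Nat.exists_eq_add_of_le' hj
  have hk : k + 2 - 1 = k + 1 := rfl
  rw [exponent, Nat.add_sub_cancel, hk]
  ext n
  simp only [map_sub, coeff_derivative, coeff_C_mul, coeff_smul, coeff_X_pow]
  simp only [Algebra.smul_def, sub_mul, Nat.factorial_succ, Nat.cast_mul, mul_inv, map_mul]
  congr 1
  · by_cases h : n = 0 <;> simp [h, coeff_X, coeff_C]
  · by_cases h : n = k
    · subst h
      have h : ((n : R) + 1) = algebraMap ℚ R ((n + 1 : ℕ) : ℚ) := by simp
      have h2 : algebraMap ℚ R (((n + 1 : ℕ) : ℚ)⁻¹) * algebraMap ℚ R ((n + 1 : ℕ) : ℚ) = 1 := by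
        rw [← map_mul, inv_mul_cancel₀ (by positivity), map_one]
      rw [h]
      simp only [if_true, mul_one]
      linear_combination (algebraMap ℚ R (n ! : ℚ)⁻¹ * y ^ d) * h2
    · simp [h]

/-- The logarithmic derivative of the reciprocal of the denominator. -/
def wordSeries (j d : ℕ) (y : R) : PowerSeries R :=
  C y * expOf (exponent j d y) * invOfUnit (denominator j d y) 1

theorem denominator_mul_invOfUnit (j d : ℕ) (y : R) :
    denominator j d y * invOfUnit (denominator j d y) 1 = 1 :=
  mul_invOfUnit _ 1 (by simpa using constantCoeff_denominator j d y)

theorem derivative_denominator (j d : ℕ) (y : R) :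
    d⁄dX R (denominator j d y) = -(C y * expOf (exponent j d y)) := by
  rw [denominator_eq, map_sub, derivative_one, Derivation.leibniz, derivative_C,
    derivative_integral]
  simp

theorem derivative_powOf_denominator (j d : ℕ) (x y : R) :
    d⁄dX R (powOf (denominator j d y) (-x)) =
      C x * (wordSeries j d y * powOf (denominator j d y) (-x)) := by
  have h := mul_derivative_powOf (constantCoeff_denominator j d y) (-x)
  have h1 := denominator_mul_invOfUnit j d y
  rw [derivative_denominator, map_neg] at h
  rw [wordSeries]
  linear_combination invOfUnit (denominator j d y) 1 * h
    - d⁄dX R (powOf (denominator j d y) (-x)) * h1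

/-- With `V = 1/D`, differentiating `D V = 1` gives `V' = y exp(E) V²`. Hence the logarithmic
derivative of `y exp(E) V` is `E' + W`. -/
theorem derivative_wordSeries {j : ℕ} (hj : 2 ≤ j) (d : ℕ) (y : R) :
    d⁄dX R (wordSeries j d y) =
      (wordSeries j d y + C (1 - y) - (((j - 2).factorial : ℚ)⁻¹) • (C (y ^ d) * X ^ (j - 2)))
        * wordSeries j d y := by
  have h1 := denominator_mul_invOfUnit j d y
  have h2 := congrArg (d⁄dX R) h1
  have h3 := derivative_exponent hj d y
  rw [Derivation.leibniz, derivative_denominator, derivative_one] at h2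
  simp only [smul_eq_mul] at h2
  rw [add_sub_assoc, ← h3, wordSeries, Derivation.leibniz, Derivation.leibniz,
    derivative_expOf (constantCoeff_exponent hj d y), derivative_C]
  simp only [smul_eq_mul, mul_zero, add_zero]
  generalize invOfUnit (denominator j d y) 1 = V at *
  linear_combination (C y * expOf (exponent j d y) * V) * h2
    - (C y * expOf (exponent j d y) * d⁄dX R V) * h1

theorem egfCoeff_zero_wordSeries {j : ℕ} (hj : 2 ≤ j) (d : ℕ) (y : R) :
    egfCoeff 0 (wordSeries j d y) = y := by
  simp [egfCoeff, wordSeries, constantCoeff_expOf (constantCoeff_exponent hj d y)]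

/-- The shape is chosen to match `wordSum_insert`: `n.choose k` counts the sets `U` of `k` letters
placed before the minimum, and the two conditional terms are the coefficients of `E'`. -/
theorem egfCoeff_succ_wordSeries {j : ℕ} (hj : 2 ≤ j) (d : ℕ) (y : R) (n : ℕ) :
    egfCoeff (n + 1) (wordSeries j d y) =
      ∑ k ∈ Finset.range (n + 1), n.choose k •
        ((egfCoeff k (wordSeries j d y) + (if k = 0 then 1 - y else 0)
          - (if k = j - 2 then y ^ d else 0)) * egfCoeff (n - k) (wordSeries j d y)) := by
  rw [egfCoeff_succ, derivative_wordSeries hj, egfCoeff_mul]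
  refine Finset.sum_congr rfl fun k _ => ?_
  congr 2
  simp only [egfCoeff, map_add, map_sub, coeff_C, coeff_smul, coeff_C_mul, coeff_X_pow, mul_add,
    mul_sub]
  congr 1
  · congr 1
    by_cases h : k = 0 <;> simp [h]
  · by_cases h : k = j - 2
    · subst h
      have h : ((j - 2) ! : R) = algebraMap ℚ R ((j - 2) ! : ℚ) := by simp
      rw [if_pos rfl, if_pos rfl, Algebra.smul_def, h, ← mul_assoc, ← map_mul,
        mul_inv_cancel₀ (by positivity), map_one, one_mul, mul_one]
    · simp [h]

theorem egfCoeff_zero_powOf_denominator (j d : ℕ) (x y : R) :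
    egfCoeff 0 (powOf (denominator j d y) (-x)) = 1 := by
  simp [egfCoeff, constantCoeff_powOf (constantCoeff_denominator j d y)]

theorem egfCoeff_succ_powOf_denominator (j d : ℕ) (x y : R) (n : ℕ) :
    egfCoeff (n + 1) (powOf (denominator j d y) (-x)) =
      ∑ k ∈ Finset.range (n + 1), n.choose k •
        ((x * egfCoeff k (wordSeries j d y)) *
          egfCoeff (n - k) (powOf (denominator j d y) (-x))) := by
  rw [egfCoeff_succ, derivative_powOf_denominator, ← mul_assoc, egfCoeff_mul]
  refine Finset.sum_congr rfl fun k _ => ?_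
  congr 2
  simp only [egfCoeff, coeff_C_mul]
  ring

end PowerSeriesIdentities

/-! ### Words on a finite set of letters, cut at their smallest letter. -/

section Words

variable {α : Type*} [LinearOrder α]

/-- The number of descents of a word given as a list. -/
def listDes : List α → ℕ
  | [] => 0
  | [_] => 0
  | a :: b :: l => (if b < a then 1 else 0) + listDes (b :: l)

theorem des_eq_listDes : ∀ {p : ℕ} (w : Fin p → α), des w = listDes (List.ofFn w)
  | 0, _ => by simp [des, listDes]
  | 1, w => by
    have h : ∀ i : Fin 1, ¬ ∃ h : (i : ℕ) + 1 < 1, w ⟨(i : ℕ) + 1, h⟩ < w i :=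
      fun i ⟨h, _⟩ => by omega
    simp only [des, h, Finset.filter_false, Finset.card_empty, List.ofFn_succ, List.ofFn_zero,
      listDes]
  | p + 2, w => by
    have ih := des_eq_listDes fun i => w (Fin.succ i)
    rw [List.ofFn_succ] at ih
    rw [List.ofFn_succ, List.ofFn_succ, listDes, ← ih, des, Fin.card_filter_univ_succ]
    have h1 : (∃ h : ((0 : Fin (p + 2)) : ℕ) + 1 < p + 2,
        w ⟨((0 : Fin (p + 2)) : ℕ) + 1, h⟩ < w 0) ↔ w (Fin.succ 0) < w 0 :=
      ⟨fun ⟨_, h⟩ => h, fun h => ⟨by simp, h⟩⟩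
    simp only [h1]
    have h2 : (Finset.univ.filter ((fun i : Fin (p + 2) =>
        ∃ h : (i : ℕ) + 1 < p + 2, w ⟨(i : ℕ) + 1, h⟩ < w i) ∘ Fin.succ)).card =
        des fun i => w (Fin.succ i) := by
      rw [des]
      congr 1
      ext i
      simp only [Finset.mem_filter, Finset.mem_univ, true_and, Function.comp, Fin.val_succ]
      exact ⟨fun ⟨h, h'⟩ => ⟨by omega, h'⟩, fun ⟨h, h'⟩ => ⟨by omega, h'⟩⟩
    rw [← h2]
    split_ifs
    · exact Nat.add_comm _ _
    · exact (Nat.zero_add _).symm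

theorem listDes_cons_of_forall_lt {m : α} {l : List α} (h : ∀ a ∈ l, m < a) :
    listDes (m :: l) = listDes l := by
  cases l with
  | nil => rfl
  | cons a l => rw [listDes, if_neg (h a (by simp)).not_gt, zero_add]

/-- A nonempty `u` always descends into the smaller letter `m`, and there is never a descent out of
`m`. -/
theorem listDes_append_cons {m : α} : ∀ {u : List α} (v : List α), (∀ a ∈ u, m < a) →
    (∀ a ∈ v, m < a) →
    listDes (u ++ m :: v) = (if u = [] then 0 else 1 + listDes u) + listDes v
  | [], v, _, hv => by simp [listDes_cons_of_forall_lt hv]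
  | [a], v, hu, hv => by
    have : m < a := hu a (by simp)
    simp [listDes, listDes_cons_of_forall_lt hv, this]
  | a :: b :: u, v, hu, hv => by
    have ih := listDes_append_cons (u := b :: u) v (fun x hx => hu x (by simp [hx])) hv
    simp only [List.cons_append, listDes, reduceCtorEq, if_false] at ih ⊢
    rw [ih]
    omega

/-- The words whose letters are exactly the elements of `T`, each used once. -/
def words (T : Finset α) : Finset (List α) :=
  T.toList.permutations.toFinset

theorem mem_words {T : Finset α} {l : List α} : l ∈ words T ↔ l.Nodup ∧ l.toFinset = T := by
  rw [words, List.mem_toFinset, List.mem_permutations]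
  constructor
  · intro h
    refine ⟨h.nodup_iff.mpr T.nodup_toList, ?_⟩
    rw [List.toFinset_eq_of_perm _ _ h, Finset.toList_toFinset]
  · rintro ⟨h, rfl⟩
    exact (List.toFinset_toList h).symm

theorem mem_iff_of_mem_words {T : Finset α} {l : List α} (h : l ∈ words T) {a : α} :
    a ∈ l ↔ a ∈ T := by
  rw [← (mem_words.mp h).2, List.mem_toFinset]

theorem length_of_mem_words {T : Finset α} {l : List α} (h : l ∈ words T) :
    l.length = T.card := by
  obtain ⟨h1, rfl⟩ := mem_words.mp h
  exact (List.toFinset_card_of_nodup h1).symm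

theorem words_empty : words (∅ : Finset α) = {[]} := by
  ext l
  rw [mem_words, Finset.mem_singleton, List.toFinset_eq_empty_iff]
  exact ⟨fun h => h.2, fun h => ⟨by simp [h], h⟩⟩

theorem sum_words_insert {M : Type*} [AddCommMonoid M] {m : α} {T : Finset α} (hm : m ∉ T)
    (F : List α → M) :
    ∑ l ∈ words (insert m T), F l =
      ∑ U ∈ T.powerset, ∑ u ∈ words U, ∑ v ∈ words (T \ U), F (u ++ m :: v) := by
  simp_rw [← Finset.sum_product']
  rw [Finset.sum_sigma']
  symm
  refine Finset.sum_bij (fun p _ => p.2.1 ++ m :: p.2.2) ?_ ?_ ?_ fun _ _ => rfl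
  · rintro ⟨U, u, v⟩ h
    simp only [Finset.mem_sigma, Finset.mem_powerset, Finset.mem_product, mem_words] at h ⊢
    obtain ⟨hU, ⟨hu, rfl⟩, hv, hvT⟩ := h
    have hmu : m ∉ u := fun h => hm (hU (by simpa using h))
    have hmv : m ∉ v := fun h => by
      rw [← List.mem_toFinset, hvT] at h
      exact hm (Finset.mem_sdiff.mp h).1
    constructor
    · rw [List.nodup_append]
      refine ⟨hu, List.nodup_cons.mpr ⟨hmv, hv⟩, ?_⟩
      rintro a ha b hb rfl
      rcases List.mem_cons.mp hb with rfl | hb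
      · exact hmu ha
      · rw [← List.mem_toFinset, hvT, Finset.mem_sdiff] at hb
        exact hb.2 (by simpa using ha)
    · rw [List.toFinset_append, List.toFinset_cons, hvT, Finset.union_insert,
        Finset.union_sdiff_of_subset hU]
  · rintro ⟨U, u, v⟩ h ⟨U', u', v'⟩ h' heq
    simp only [Finset.mem_sigma, Finset.mem_powerset, Finset.mem_product, mem_words] at h h'
    obtain ⟨hU, ⟨hu, rfl⟩, hv, hvT⟩ := h
    obtain ⟨hU', ⟨hu', rfl⟩, hv', hvT'⟩ := h'
    have hmu : m ∉ u := fun h => hm (hU (by simpa using h))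
    have hmu' : m ∉ u' := fun h => hm (hU' (by simpa using h))
    dsimp only at heq
    have hmv : m ∉ v := fun h => by
      rw [← List.mem_toFinset, hvT] at h
      exact hm (Finset.mem_sdiff.mp h).1
    obtain ⟨rfl, rfl⟩ : u = u' ∧ v = v' := by
      have := List.append_eq_append_iff.mp heq
      rcases this with ⟨a, rfl, ha⟩ | ⟨a, rfl, ha⟩ <;> cases a <;> simp_all
    rfl
  · intro l hl
    obtain ⟨hnd, hlT⟩ := mem_words.mp hl
    have hml : m ∈ l := by
      rw [← List.mem_toFinset, hlT]
      exact Finset.mem_insert_self _ _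
    obtain ⟨u, v, rfl⟩ := List.append_of_mem hml
    rw [List.nodup_append, List.nodup_cons] at hnd
    obtain ⟨hu, ⟨hmv, hv⟩, hd⟩ := hnd
    have hmu : m ∉ u := fun h => hd m h m (by simp) rfl
    have hT : T = u.toFinset ∪ v.toFinset := by
      rw [← Finset.erase_insert hm, ← hlT]
      ext a
      simp only [List.toFinset_append, List.toFinset_cons, Finset.mem_erase, Finset.mem_union,
        Finset.mem_insert, List.mem_toFinset]
      constructor
      · tauto
      · rintro (h | h)
        · exact ⟨fun e => hmu (e ▸ h), .inl h⟩
        · exact ⟨fun e => hmv (e ▸ h), .inr (.inr h)⟩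
    refine ⟨⟨u.toFinset, u, v⟩, ?_, rfl⟩
    simp only [Finset.mem_sigma, Finset.mem_powerset, Finset.mem_product, mem_words]
    refine ⟨hT ▸ Finset.subset_union_left, ⟨hu, trivial⟩, hv, ?_⟩
    rw [hT, Finset.union_sdiff_left, eq_comm, Finset.sdiff_eq_self_iff_disjoint,
      Finset.disjoint_left]
    intro a ha hb
    exact hd a (by simpa using hb) a (by simpa using Or.inr ha) rfl

end Words

/-! ### Consecutive matches of `τ`, and where they can lie relative to the minimum. -/

section Matches

variable {α : Type*} [LinearOrder α] {j : ℕ} {τ : Equiv.Perm (Fin j)}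

/-- The letters of the word `w` are in the same relative order as those of `τ`. -/
def IsMatch (τ : Equiv.Perm (Fin j)) (w : List α) : Prop :=
  w.length = j ∧ ∀ (i k : ℕ) (hi : i < w.length) (hk : k < w.length) (hi' : i < j) (hk' : k < j),
    w[i] < w[k] ↔ τ ⟨i, hi'⟩ < τ ⟨k, hk'⟩

/-- No consecutive part of the word `l` is a match of `τ`. -/
def Avoids (τ : Equiv.Perm (Fin j)) (l : List α) : Prop :=
  ∀ w, w <:+: l → ¬ IsMatch τ w

theorem isMatch_ofFn {f : Fin j → α} :
    IsMatch τ (List.ofFn f) ↔ ∀ a b, f a < f b ↔ τ a < τ b := by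
  constructor
  · rintro ⟨_, h⟩ a b
    simpa using h a b (by simp) (by simp) a.2 b.2
  · intro h
    refine ⟨List.length_ofFn, fun i k hi hk hi' hk' => ?_⟩
    simpa using h ⟨i, hi'⟩ ⟨k, hk'⟩

theorem Avoids.of_infix {l l' : List α} (h : Avoids τ l) (hl : l' <:+: l) : Avoids τ l' :=
  fun w hw => h w (hw.trans hl)

theorem avoids_of_length_lt {l : List α} (h : l.length < j) : Avoids τ l :=
  fun w hw hm => by
    have := hw.length_le
    have := hm.1
    omega

theorem IsMatch.ofFn_getElem {w : List α} (h : IsMatch τ w) :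
    w = List.ofFn fun i : Fin j => w[(i : ℕ)]'(h.1.symm ▸ i.2) :=
  List.ext_getElem (by simp [h.1]) (by simp)

theorem IsMatch.listDes_eq {w : List α} (h : IsMatch τ w) : listDes w = des τ := by
  rw [h.ofFn_getElem, ← des_eq_listDes, des, des]
  congr 1
  ext i
  simp only [Finset.mem_filter, Finset.mem_univ, true_and]
  exact exists_congr fun hi => h.2 _ _ _ _ hi i.2

theorem IsMatch.eq_ofFn {w : List α} (h : IsMatch τ w) {V : Finset α} (hV : V.card = j)
    (hw : ∀ a ∈ w, a ∈ V) : w = List.ofFn fun i => V.orderEmbOfFin hV (τ i) := by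
  have hlt (i : Fin j) : (i : ℕ) < w.length := h.1.symm ▸ i.2
  -- Read in the order prescribed by `τ⁻¹`, the letters of `w` increase, so they are the increasing
  -- enumeration of `V`.
  have key : (fun i : Fin j => w[((τ⁻¹ i : Fin j) : ℕ)]'(hlt _)) = V.orderEmbOfFin hV := by
    refine Finset.orderEmbOfFin_unique hV (fun i => hw _ (List.getElem_mem _)) fun a b hab => ?_
    refine (h.2 _ _ (hlt _) (hlt _) (τ⁻¹ a).2 (τ⁻¹ b).2).mpr ?_
    simpa using hab
  refine h.ofFn_getElem.trans (congrArg List.ofFn (funext fun i => ?_))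
  rw [← key]
  simp

theorem isMatch_ofFn_orderEmbOfFin {V : Finset α} (hV : V.card = j) :
    IsMatch τ (List.ofFn fun i => V.orderEmbOfFin hV (τ i)) :=
  isMatch_ofFn.mpr fun _ _ => (V.orderEmbOfFin hV).lt_iff_lt

theorem ofFn_orderEmbOfFin_mem_words {V : Finset α} (hV : V.card = j) :
    (List.ofFn fun i => V.orderEmbOfFin hV (τ i)) ∈ words V := by
  rw [mem_words]
  have hnd : (List.ofFn fun i => V.orderEmbOfFin hV (τ i)).Nodup :=
    List.nodup_ofFn.mpr ((V.orderEmbOfFin hV).injective.comp τ.injective)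
  refine ⟨hnd, ?_⟩
  refine Finset.eq_of_subset_of_card_le (fun a ha => ?_) ?_
  · obtain ⟨i, rfl⟩ := (List.mem_ofFn' _ _).mp (List.mem_toFinset.mp ha)
    exact Finset.orderEmbOfFin_mem _ _ _
  · rw [List.toFinset_card_of_nodup hnd, List.length_ofFn, hV]

theorem IsMatch.head_lt (h0 : 0 < j) (h_first : (τ ⟨0, h0⟩ : ℕ) = 0) {a b : α} {s : List α}
    (h : IsMatch τ (a :: s)) (hb : b ∈ s) : a < b := by
  obtain ⟨i, hi, rfl⟩ := List.getElem_of_mem hb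
  have hlen := h.1
  rw [List.length_cons] at hlen
  have := h.2 0 (i + 1) (by simp) (by simpa using hi) h0 (by omega)
  simp only [List.getElem_cons_zero, List.getElem_cons_succ] at this
  refine this.mpr (Fin.lt_def.mpr ?_)
  rw [h_first, Nat.pos_iff_ne_zero, ← h_first]
  intro he
  have := τ.injective (Fin.ext he)
  simp at this

theorem IsMatch.last_lt (h0 : 0 < j) (h_first : (τ ⟨0, h0⟩ : ℕ) = 0)
    (h_last : (τ ⟨j - 1, Nat.sub_one_lt_of_lt h0⟩ : ℕ) = 1) {a b z : α} {s : List α}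
    (h : IsMatch τ (a :: s ++ [z])) (hb : b ∈ s) : z < b := by
  obtain ⟨i, hi, rfl⟩ := List.getElem_of_mem hb
  have hlen := h.1
  simp only [List.cons_append, List.length_cons, List.length_append, List.length_nil] at hlen
  have := h.2 (j - 1) (i + 1) (by simp; omega) (by simp; omega) (by omega) (by omega)
  have e1 : j - 1 = s.length + 1 := by omega
  simp only [e1, List.cons_append, List.getElem_cons_succ, List.getElem_append_left hi] at this
  rw [List.getElem_append_right le_rfl] at this
  simp only [Nat.sub_self, List.getElem_cons_zero] at this
  refine this.mpr (Fin.lt_def.mpr ?_)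
  have ne0 : (τ ⟨i + 1, by omega⟩ : ℕ) ≠ 0 := fun he => by
    have := τ.injective (Fin.ext (he.trans h_first.symm))
    simp at this
  have ne1 : (τ ⟨i + 1, by omega⟩ : ℕ) ≠ 1 := fun he => by
    have := τ.injective (Fin.ext (he.trans h_last.symm))
    simp at this
    omega
  simp only [e1] at h_last
  rw [h_last]
  omega

/-- Consider a match that contains `m` and begins before it. If it begins inside `u`, its first
letter exceeds `m`, although it should be the smallest. If it begins at `m₀` and runs beyond `m`,
its last letter lies in `v` and exceeds `m`, although it should be the second smallest. Only `m₀ u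
m` itself remains. -/
theorem avoids_append_cons_iff (h0 : 0 < j) (h_first : (τ ⟨0, h0⟩ : ℕ) = 0)
    (h_last : (τ ⟨j - 1, Nat.sub_one_lt_of_lt h0⟩ : ℕ) = 1) {m₀ m : α} {u v : List α}
    (hu : ∀ a ∈ u, m < a) (hv : ∀ a ∈ v, m < a) :
    Avoids τ (m₀ :: (u ++ m :: v)) ↔
      Avoids τ (m₀ :: u) ∧ Avoids τ (m :: v) ∧ ¬ IsMatch τ (m₀ :: u ++ [m]) := by
  constructor
  · intro h
    refine ⟨h.of_infix ⟨[], m :: v, by simp⟩, h.of_infix ⟨m₀ :: u, [], by simp⟩,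
      h _ ⟨[], v, by simp⟩⟩
  · rintro ⟨h1, h2, h3⟩ w ⟨s, t, hst⟩ hw
    rw [List.append_assoc, ← List.cons_append, List.append_eq_append_iff] at hst
    rcases hst with ⟨a, ha, hwt⟩ | ⟨a, rfl, hwt⟩
    · rw [List.append_eq_append_iff] at hwt
      rcases hwt with ⟨c, rfl, -⟩ | ⟨c, rfl, hc⟩
      · exact h1 w ⟨s, c, by simp [ha]⟩ hw
      cases c with
      | nil => exact h1 a ⟨s, [], by simp [ha]⟩ (by simpa using hw)
      | cons m' c =>
        obtain ⟨rfl, rfl⟩ := List.cons.inj hc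
        cases a with
        | nil => exact h2 _ ⟨[], t, by simp⟩ hw
        | cons x a =>
          cases s with
          | nil =>
            obtain ⟨rfl, rfl⟩ := List.cons.inj ha
            rcases List.eq_nil_or_concat c with rfl | ⟨c, z, rfl⟩
            · exact h3 hw
            · have h := IsMatch.last_lt h0 h_first h_last (a := m₀) (b := m) (z := z)
                (s := u ++ m :: c) (by simpa using hw) (by simp)
              exact absurd h (hv z (by simp)).not_gt
          | cons y s =>
            obtain ⟨rfl, rfl⟩ := List.cons.inj ha
            exact absurd (hw.head_lt h0 h_first (b := m) (by simp)) (hu x (by simp)).not_gt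
    · exact h2 w ⟨a, t, by simp [hwt]⟩ hw

/-- A match is determined by its set of letters. Arranging `{m₀, m} ∪ U` in the order of `τ` puts
the smallest letter `m₀` first and the second smallest `m` last, which leaves an arrangement of `U`
between them. -/
theorem existsUnique_match (hj : 3 ≤ j) (h_first : (τ ⟨0, Nat.zero_lt_of_lt hj⟩ : ℕ) = 0)
    (h_last : (τ ⟨j - 1, Nat.sub_one_lt_of_lt hj⟩ : ℕ) = 1) {m₀ m : α} {U : Finset α}
    (hm : m₀ < m)
    (hU : ∀ a ∈ U, m < a) (hc : U.card = j - 2) :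
    ∃! u, u ∈ words U ∧ IsMatch τ (m₀ :: u ++ [m]) := by
  have hmU : m ∉ U := fun h => (hU m h).false
  have hm₀U : m₀ ∉ insert m U := fun h => by
    rcases Finset.mem_insert.mp h with h | h
    · exact hm.ne h
    · exact (hm.trans (hU _ h)).false
  set V := insert m₀ (insert m U) with hVdef
  have hV : V.card = j := by
    rw [Finset.card_insert_of_notMem hm₀U, Finset.card_insert_of_notMem hmU]
    omega
  have huniq {u : List α} (hu : u ∈ words U) (h : IsMatch τ (m₀ :: u ++ [m])) :=
    h.eq_ofFn hV fun a ha => by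
      simp only [List.cons_append, List.mem_cons, List.mem_append, mem_iff_of_mem_words hu,
        List.not_mem_nil, or_false] at ha
      simp only [hVdef, Finset.mem_insert]
      tauto
  have hw := isMatch_ofFn_orderEmbOfFin (τ := τ) hV
  have hwV := ofFn_orderEmbOfFin_mem_words (τ := τ) hV
  generalize hwdef : (List.ofFn fun i => V.orderEmbOfFin hV (τ i)) = w at hw hwV huniq
  obtain ⟨a, u, z, rfl⟩ : ∃ a u z, w = a :: u ++ [z] := by
    have hl := hw.1
    cases w with
    | nil => simp at hl; omega
    | cons a s =>
      rcases List.eq_nil_or_concat s with rfl | ⟨u, z, rfl⟩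
      · simp at hl; omega
      · exact ⟨a, u, z, by simp⟩
  have hmem (b : α) : b ∈ a :: u ++ [z] ↔ b ∈ V := mem_iff_of_mem_words hwV
  have hfirst (b : α) (hb : b ∈ u ++ [z]) : a < b := hw.head_lt (Nat.zero_lt_of_lt hj) h_first hb
  have hlast (b : α) (hb : b ∈ u) : z < b := hw.last_lt (Nat.zero_lt_of_lt hj) h_first h_last hb
  have ham : a = m₀ := by
    have h1 : a ∈ V := (hmem a).mp (by simp)
    have h2 : m₀ ∈ a :: u ++ [z] := (hmem m₀).mpr (by simp [hVdef])
    rcases List.mem_cons.mp h2 with h | h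
    · exact h.symm
    · have h3 := hfirst _ h
      simp only [hVdef, Finset.mem_insert] at h1
      rcases h1 with h1 | h1 | h1
      · exact h1
      · exact absurd (h1 ▸ h3) hm.not_gt
      · exact absurd h3 (hm.trans (hU a h1)).not_gt
  subst ham
  have hzm : z = m := by
    have h1 : z ∈ V := (hmem z).mp (by simp)
    have h2 : m ∈ a :: u ++ [z] := (hmem m).mpr (by simp [hVdef])
    have h3 := hfirst z (by simp)
    simp only [hVdef, Finset.mem_insert] at h1
    simp only [List.cons_append, List.mem_cons, List.mem_append, List.not_mem_nil,
      or_false] at h2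
    rcases h2 with h2 | h2 | h2
    · exact absurd h2 hm.ne'
    · have h4 := hlast m h2
      rcases h1 with h1 | h1 | h1
      · exact absurd h1 h3.ne'
      · exact h1
      · exact absurd h4 (hU z h1).not_gt
    · exact h2.symm
  subst hzm
  refine ⟨u, ⟨mem_words.mpr ?_, hw⟩, fun u' hu' => ?_⟩
  · have hnd := (mem_words.mp hwV).1
    have hnd' : a ∉ u ++ [z] ∧ (u ++ [z]).Nodup := List.nodup_cons.mp hnd
    refine ⟨(List.nodup_append.mp hnd'.2).1, ?_⟩
    ext b
    have hb := hmem b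
    simp only [List.cons_append, List.mem_cons, List.mem_append, List.not_mem_nil,
      or_false, hVdef, Finset.mem_insert] at hb
    rw [List.mem_toFinset]
    constructor
    · intro h
      have h1 := hlast b h
      have h2 := hm.trans h1
      rcases hb.mp (.inr (.inl h)) with h | h | h
      · exact absurd h h2.ne'
      · exact absurd h h1.ne'
      · exact h
    · intro h
      have h1 := hU b h
      have h2 := hm.trans h1
      rcases hb.mpr (.inr (.inr h)) with h | h | h
      · exact absurd h h2.ne'
      · exact h
      · exact absurd h h1.ne'
  · have := huniq hu'.1 hu'.2
    simpa using this

end Matches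

/-! ### The recursion for weighted words that avoid `τ`. -/

section WordSum

variable {α : Type*} [LinearOrder α] {j : ℕ} {R : Type*} [CommRing R]

open Classical in
/-- The weight `y ^ (1 + des)` of the word `m l`, or `0` if it contains a match of `τ`. -/
def wordWeight (τ : Equiv.Perm (Fin j)) (y : R) (m : α) (l : List α) : R :=
  if Avoids τ (m :: l) then y ^ (1 + listDes l) else 0

/-- The total weight of the words that start with `m` and continue with the letters in `T`. -/
def wordSum (τ : Equiv.Perm (Fin j)) (y : R) (m : α) (T : Finset α) : R :=
  ∑ l ∈ words T, wordWeight τ y m l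

variable {τ : Equiv.Perm (Fin j)}

open Classical in
-- For empty `u` the first factor must be `1`, and `y + (1 - y)` provides it. If `m₀ u m` is a
-- match, then `m₀ u` is too short to contain one, so its weight `y^(1 + des u) = y^(des τ)` must be
-- cancelled.
theorem wordWeight_append_cons (hj : 3 ≤ j) (h_first : (τ ⟨0, Nat.zero_lt_of_lt hj⟩ : ℕ) = 0)
    (h_last : (τ ⟨j - 1, Nat.sub_one_lt_of_lt hj⟩ : ℕ) = 1) (y : R) {m₀ m : α} {u v : List α}
    (hu : ∀ a ∈ u, m < a) (hv : ∀ a ∈ v, m < a) (hm : m₀ < m) :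
    wordWeight τ y m₀ (u ++ m :: v) =
      (wordWeight τ y m₀ u + (if u = [] then 1 - y else 0)
        - (if IsMatch τ (m₀ :: u ++ [m]) then y ^ des τ else 0)) * wordWeight τ y m v := by
  simp only [wordWeight, avoids_append_cons_iff (Nat.zero_lt_of_lt hj) h_first h_last hu hv,
    listDes_append_cons v hu hv]
  by_cases h2 : Avoids τ (m :: v)
  swap
  · simp [h2]
  by_cases h0 : u = []
  · subst h0
    have h1 : Avoids τ [m₀] := avoids_of_length_lt (by simp; omega)
    have h3 : ¬ IsMatch τ [m₀, m] := fun h => by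
      have := h.1
      simp at this
      omega
    simp [h1, h2, h3, listDes]
  by_cases h3 : IsMatch τ (m₀ :: u ++ [m])
  · have h1 : Avoids τ (m₀ :: u) := avoids_of_length_lt (by have := h3.1; simp at this ⊢; omega)
    have hd : des τ = 1 + listDes u := by
      rw [← h3.listDes_eq, List.cons_append, listDes_cons_of_forall_lt, listDes_append_cons]
      · simp [h0, listDes]
      · exact hu
      · simp
      · intro a ha
        rcases List.mem_append.mp ha with h | h
        · exact hm.trans (hu a h)
        · rw [List.mem_singleton.mp h]
          exact hm
    rw [if_neg fun h => h.2.2 h3, if_pos h1, if_neg h0, if_pos h3, hd]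
    ring
  · by_cases h1 : Avoids τ (m₀ :: u)
    · rw [if_pos ⟨h1, h2, h3⟩, if_pos h1, if_neg h0, if_neg h3, if_pos h2, if_neg h0]
      ring
    · rw [if_neg fun h => h1 h.1, if_neg h1, if_neg h0, if_neg h3]
      ring

theorem wordSum_empty (hj : 2 ≤ j) (y : R) (m : α) : wordSum τ y m ∅ = y := by
  have h1 : Avoids τ [m] := avoids_of_length_lt (by simp; omega)
  simp [wordSum, words_empty, wordWeight, h1, listDes]

open Classical in
theorem sum_words_match (hj : 3 ≤ j) (h_first : (τ ⟨0, Nat.zero_lt_of_lt hj⟩ : ℕ) = 0)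
    (h_last : (τ ⟨j - 1, Nat.sub_one_lt_of_lt hj⟩ : ℕ) = 1) (r : R) {m₀ m : α} {U : Finset α}
    (hm : m₀ < m)
    (hU : ∀ a ∈ U, m < a) :
    ∑ u ∈ words U, (if IsMatch τ (m₀ :: u ++ [m]) then r else 0) =
      if U.card = j - 2 then r else 0 := by
  split_ifs with h
  · obtain ⟨u, ⟨hu, hum⟩, huniq⟩ := existsUnique_match hj h_first h_last hm hU h
    rw [Finset.sum_eq_single_of_mem u hu, if_pos hum]
    exact fun u' hu' hne => if_neg fun h => hne (huniq u' ⟨hu', h⟩)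
  · refine Finset.sum_eq_zero fun u hu => if_neg fun hmatch => h ?_
    have := hmatch.1
    simp only [List.cons_append, List.length_cons, List.length_append, List.length_nil,
      length_of_mem_words hu] at this
    omega

theorem sum_words_nil (r : R) (U : Finset α) :
    ∑ u ∈ words U, (if u = [] then r else 0) = if U.card = 0 then r else 0 := by
  rw [Finset.sum_ite_eq']
  congr 1
  rw [mem_words, Finset.card_eq_zero]
  simp [eq_comm]

theorem wordSum_insert (hj : 3 ≤ j) (h_first : (τ ⟨0, Nat.zero_lt_of_lt hj⟩ : ℕ) = 0)
    (h_last : (τ ⟨j - 1, Nat.sub_one_lt_of_lt hj⟩ : ℕ) = 1) (y : R) {m₀ m : α} {T : Finset α}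
    (hm : m₀ < m)
    (hT : ∀ a ∈ T, m < a) :
    wordSum τ y m₀ (insert m T) =
      ∑ U ∈ T.powerset, (wordSum τ y m₀ U + (if U.card = 0 then 1 - y else 0)
        - (if U.card = j - 2 then y ^ des τ else 0)) * wordSum τ y m (T \ U) := by
  classical
  rw [wordSum, sum_words_insert fun h => (hT m h).false]
  refine Finset.sum_congr rfl fun U hU => ?_
  have hUT := Finset.mem_powerset.mp hU
  rw [← sum_words_match hj h_first h_last (y ^ des τ) hm fun a ha => hT a (hUT ha),
    ← sum_words_nil, wordSum, wordSum, ← Finset.sum_add_distrib, ← Finset.sum_sub_distrib,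
    Finset.sum_mul_sum]
  refine Finset.sum_congr rfl fun u hu => Finset.sum_congr rfl fun v hv => ?_
  refine wordWeight_append_cons hj h_first h_last y (fun a ha => hT a ?_) (fun a ha => hT a ?_) hm
  · exact hUT ((mem_iff_of_mem_words hu).mp ha)
  · exact (Finset.mem_sdiff.mp ((mem_iff_of_mem_words hv).mp ha)).1

theorem wordSum_eq_egfCoeff [Algebra ℚ R] (hj : 3 ≤ j)
    (h_first : (τ ⟨0, Nat.zero_lt_of_lt hj⟩ : ℕ) = 0)
    (h_last : (τ ⟨j - 1, Nat.sub_one_lt_of_lt hj⟩ : ℕ) = 1) (y : R) (T : Finset α) :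
    ∀ m₀, (∀ a ∈ T, m₀ < a) →
      wordSum τ y m₀ T = egfCoeff T.card (wordSeries j (des τ) y) := by
  -- The first letter stays universally quantified: the recursion needs `m₀` for the part `U` and
  -- `m` for the part `T \ U`.
  induction T using Finset.strongInduction with
  | H T ih =>
  intro m₀ hm₀
  rcases T.eq_empty_or_nonempty with rfl | hne
  · rw [wordSum_empty (by omega), Finset.card_empty, egfCoeff_zero_wordSeries (by omega)]
  obtain ⟨m, hm, hmin⟩ := T.exists_minimal hne
  have hlt : ∀ a ∈ T.erase m, m < a := fun a ha => by
    obtain ⟨h1, h2⟩ := Finset.mem_erase.mp ha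
    exact (le_total a m).elim (fun h => (hmin h2 h).lt_of_ne h1.symm)
      fun h => h.lt_of_ne h1.symm
  have hss := Finset.erase_ssubset hm
  have hcard := Finset.card_erase_add_one hm
  conv_lhs => rw [← Finset.insert_erase hm]
  rw [wordSum_insert hj h_first h_last y (hm₀ m hm) hlt, ← hcard,
    egfCoeff_succ_wordSeries (by omega), ← Finset.sum_powerset_apply_card fun k =>
      ((egfCoeff k (wordSeries j (des τ) y) + (if k = 0 then 1 - y else 0)
          - (if k = j - 2 then y ^ des τ else 0)) *
        egfCoeff ((T.erase m).card - k) (wordSeries j (des τ) y))]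
  refine Finset.sum_congr rfl fun U hU => ?_
  have hUT := Finset.mem_powerset.mp hU
  rw [ih U (hUT.trans_ssubset hss) m₀ fun a ha => hm₀ a (hss.1 (hUT ha)),
    ih (T.erase m \ U) (Finset.sdiff_subset.trans_ssubset hss) m
      fun a ha => hlt a (Finset.sdiff_subset ha), Finset.card_sdiff_of_subset hUT]

end WordSum

open Equiv.Perm

/-! ### Permutations built by splitting off the cycle through the smallest element. -/

section Cycles

variable {α : Type*}

/-- The cycle of `σ` through `c`, written as the list `[c, σ c, σ² c, …]`. -/
def cycleList (σ : Equiv.Perm α) (c : α) : List α :=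
  List.ofFn fun i : Fin (Function.minimalPeriod σ c) => (σ ^ (i : ℕ)) c

theorem length_cycleList (σ : Equiv.Perm α) (c : α) :
    (cycleList σ c).length = Function.minimalPeriod σ c :=
  List.length_ofFn

theorem getElem_cycleList (σ : Equiv.Perm α) (c : α) (i : ℕ) (hi : i < (cycleList σ c).length) :
    (cycleList σ c)[i] = (σ ^ i) c := by
  simp [cycleList]

theorem pow_mod_minimalPeriod (σ : Equiv.Perm α) (c : α) (n : ℕ) :
    (σ ^ (n % Function.minimalPeriod σ c)) c = (σ ^ n) c := by
  rw [← iterate_eq_pow, ← iterate_eq_pow, Function.iterate_mod_minimalPeriod_eq]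

theorem nodup_cycleList (σ : Equiv.Perm α) (c : α) : (cycleList σ c).Nodup := by
  refine List.nodup_ofFn.mpr fun a b hab => Fin.ext ?_
  refine Function.iterate_injOn_Iio_minimalPeriod (f := σ) (x := c) a.2 b.2 ?_
  simpa only [iterate_eq_pow] using hab

theorem cycleList_congr {σ ρ : Equiv.Perm α} {c : α} (h : ∀ n : ℕ, (σ ^ n) c = (ρ ^ n) c) :
    cycleList σ c = cycleList ρ c := by
  have hp : Function.minimalPeriod σ c = Function.minimalPeriod ρ c :=
    Function.minimalPeriod_eq_minimalPeriod_iff.mpr fun n => by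
      simp only [Function.IsPeriodicPt, Function.IsFixedPt, iterate_eq_pow, h]
  refine List.ext_getElem (by simp only [length_cycleList, hp]) fun i h1 h2 => ?_
  rw [getElem_cycleList, getElem_cycleList, h]

theorem minimalPeriod_pos [Finite α] (σ : Equiv.Perm α) (c : α) :
    0 < Function.minimalPeriod σ c := by
  refine Function.IsPeriodicPt.minimalPeriod_pos (orderOf_pos σ) ?_
  rw [Function.IsPeriodicPt, Function.IsFixedPt, iterate_eq_pow, pow_orderOf_eq_one, one_apply]

theorem cycleList_ne_nil [Finite α] (σ : Equiv.Perm α) (c : α) : cycleList σ c ≠ [] := by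
  rw [← List.length_pos_iff, length_cycleList]
  exact minimalPeriod_pos σ c

theorem cycleList_eq_cons [Finite α] (σ : Equiv.Perm α) (c : α) :
    cycleList σ c = c :: (cycleList σ c).tail := by
  have h := getElem_cycleList σ c 0 (List.length_pos_iff.mpr (cycleList_ne_nil σ c))
  rcases hl : cycleList σ c with _ | ⟨a, l⟩
  · exact absurd hl (cycleList_ne_nil σ c)
  · simp only [hl, List.getElem_cons_zero, pow_zero, one_apply] at h
    rw [h, List.tail_cons]

variable [LinearOrder α]

/-- The element `c` is the smallest one of its cycle. -/
def IsCycleMin (σ : Equiv.Perm α) (c : α) : Prop :=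
  ∀ b, σ.SameCycle c b → c ≤ b

theorem isCycleMin_congr {σ ρ : Equiv.Perm α} {c : α} (h : ∀ n : ℤ, (σ ^ n) c = (ρ ^ n) c) :
    IsCycleMin σ c ↔ IsCycleMin ρ c := by
  simp only [IsCycleMin, SameCycle, h]

theorem cycleList_formPerm {m : α} {l : List α} (h : (m :: l).Nodup) :
    cycleList (m :: l).formPerm m = m :: l := by
  have hpow (n : ℕ) : ((m :: l).formPerm ^ n) m =
      (m :: l)[n % (m :: l).length]'(Nat.mod_lt _ (by simp)) := by
    have := List.formPerm_pow_apply_getElem (m :: l) h n 0 (by simp)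
    simp only [zero_add] at this
    exact this
  have hper : Function.IsPeriodicPt (m :: l).formPerm (m :: l).length m := by
    rw [Function.IsPeriodicPt, Function.IsFixedPt, iterate_eq_pow, hpow]
    simp
  have hle := hper.minimalPeriod_le (by simp)
  have hpos := hper.minimalPeriod_pos (by simp)
  -- A shorter period would repeat the letter `m` inside a word without repetitions.
  have hlen : Function.minimalPeriod (m :: l).formPerm m = (m :: l).length := by
    by_contra hne
    have hlt := hle.lt_of_ne hne
    have h1 := Function.isPeriodicPt_minimalPeriod (m :: l).formPerm m
    rw [Function.IsPeriodicPt, Function.IsFixedPt, iterate_eq_pow, hpow] at h1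
    simp only [Nat.mod_eq_of_lt hlt] at h1
    have h2 := (h.getElem_inj_iff (j := 0) (hj := by simp)).mp (h1.trans (by simp))
    omega
  refine List.ext_getElem (by rw [length_cycleList, hlen]) fun i h1 h2 => ?_
  rw [getElem_cycleList, hpow]
  simp only [Nat.mod_eq_of_lt h2]

theorem formPerm_cycleList_apply (σ : Equiv.Perm α) (c : α) {a : α} (ha : a ∈ cycleList σ c) :
    (cycleList σ c).formPerm a = σ a := by
  obtain ⟨i, hi, rfl⟩ := List.getElem_of_mem ha
  rw [List.formPerm_apply_getElem _ (nodup_cycleList σ c), getElem_cycleList, getElem_cycleList,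
    length_cycleList, pow_mod_minimalPeriod, pow_succ', mul_apply]

theorem nodup_cons_of_mem_words {m : α} {S T : Finset α} {l : List α} (hm : m ∉ S)
    (hT : T ⊆ S) (hl : l ∈ words T) :
    (m :: l).Nodup :=
  List.nodup_cons.mpr ⟨fun h => hm (hT ((mem_iff_of_mem_words hl).mp h)), (mem_words.mp hl).1⟩

variable [Fintype α]

variable {R : Type*} [CommRing R]

open Classical in
/-- The permutations that move only elements of `S`. -/
def permsOn (S : Finset α) : Finset (Equiv.Perm α) :=
  Finset.univ.filter fun σ => ∀ a ∉ S, σ a = a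

theorem mem_permsOn {S : Finset α} {σ : Equiv.Perm α} : σ ∈ permsOn S ↔ ∀ a ∉ S, σ a = a := by
  simp [permsOn]

open Classical in
/-- The product of the weights `g C` of the cycles `C` of `σ` whose smallest element is in `S`. -/
def cycleWeight (g : List α → R) (S : Finset α) (σ : Equiv.Perm α) : R :=
  ∏ c ∈ S with IsCycleMin σ c, g (cycleList σ c)

/-- The generating function of the permutations of `S` by the weights of their cycles. -/
def permSum (g : List α → R) (S : Finset α) : R :=
  ∑ σ ∈ permsOn S, cycleWeight g S σ

theorem permSum_empty (g : List α → R) : permSum g ∅ = 1 := by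
  have h : permsOn (∅ : Finset α) = {1} := by
    ext σ
    rw [mem_permsOn, Finset.mem_singleton]
    exact ⟨fun h => Equiv.ext fun a => h a (Finset.notMem_empty a), fun h a _ => by rw [h]; rfl⟩
  simp [permSum, h, cycleWeight]

section Insert

variable {m : α} {S T : Finset α} {l : List α} {ρ : Equiv.Perm α}

theorem apply_eq_of_mem_cons (hm : m ∉ S) (hl : l ∈ words T) (hρ : ρ ∈ permsOn (S \ T)) {a : α}
    (ha : a ∈ m :: l) : ρ a = a := by
  refine mem_permsOn.mp hρ a fun h => ?_
  obtain ⟨h1, h2⟩ := Finset.mem_sdiff.mp h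
  rcases List.mem_cons.mp ha with rfl | ha
  · exact hm h1
  · exact h2 ((mem_iff_of_mem_words hl).mp ha)

theorem disjoint_formPerm (hm : m ∉ S) (hl : l ∈ words T) (hρ : ρ ∈ permsOn (S \ T)) :
    (m :: l).formPerm.Disjoint ρ := fun a => by
  by_cases ha : a ∈ m :: l
  · exact .inr (apply_eq_of_mem_cons hm hl hρ ha)
  · exact .inl (List.formPerm_apply_of_notMem ha)

theorem zpow_apply_of_mem_cons (hm : m ∉ S) (hl : l ∈ words T) (hρ : ρ ∈ permsOn (S \ T)) {a : α}
    (ha : a ∈ m :: l) (n : ℤ) : (((m :: l).formPerm * ρ) ^ n) a = ((m :: l).formPerm ^ n) a := by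
  rw [(disjoint_formPerm hm hl hρ).commute.mul_zpow, mul_apply,
    zpow_apply_eq_self_of_apply_eq_self (apply_eq_of_mem_cons hm hl hρ ha)]

theorem zpow_apply_of_notMem_cons (hm : m ∉ S) (hl : l ∈ words T) (hρ : ρ ∈ permsOn (S \ T))
    {a : α} (ha : a ∉ m :: l) (n : ℤ) : (((m :: l).formPerm * ρ) ^ n) a = (ρ ^ n) a := by
  rw [(disjoint_formPerm hm hl hρ).commute.mul_zpow,
    ((disjoint_formPerm hm hl hρ).commute.zpow_zpow n n).eq, mul_apply,
    zpow_apply_eq_self_of_apply_eq_self (List.formPerm_apply_of_notMem ha)]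

theorem cycleList_formPerm_mul (hm : m ∉ S) (hT : T ⊆ S) (hl : l ∈ words T)
    (hρ : ρ ∈ permsOn (S \ T)) : cycleList ((m :: l).formPerm * ρ) m = m :: l := by
  refine (cycleList_congr fun n => ?_).trans
    (cycleList_formPerm (nodup_cons_of_mem_words hm hT hl))
  simpa using zpow_apply_of_mem_cons hm hl hρ List.mem_cons_self (n : ℤ)

theorem formPerm_mul_mem_permsOn (hT : T ⊆ S) (hl : l ∈ words T) (hρ : ρ ∈ permsOn (S \ T)) :
    (m :: l).formPerm * ρ ∈ permsOn (insert m S) := by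
  rw [mem_permsOn]
  intro a ha
  have haS : a ∉ S := fun h => ha (Finset.mem_insert_of_mem h)
  rw [mul_apply, mem_permsOn.mp hρ a fun h => haS (Finset.mem_sdiff.mp h).1]
  refine List.formPerm_apply_of_notMem fun h => ?_
  rcases List.mem_cons.mp h with rfl | h
  · exact ha (Finset.mem_insert_self _ _)
  · exact haS (hT ((mem_iff_of_mem_words hl).mp h))

/-- The two factors are disjoint, so the cycles of the product are `m l` and those of `ρ`. Elements
of `T` are fixed by `ρ` but are not minima in the product, since they share the cycle of the smaller
`m`; this is why the weight of `ρ` is taken over `S \ T`. -/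
theorem cycleWeight_formPerm_mul (g : List α → R) (hm : ∀ a ∈ S, m < a) (hT : T ⊆ S)
    (hl : l ∈ words T) (hρ : ρ ∈ permsOn (S \ T)) :
    cycleWeight g (insert m S) ((m :: l).formPerm * ρ) =
      g (m :: l) * cycleWeight g (S \ T) ρ := by
  classical
  have hmS : m ∉ S := fun h => (hm m h).false
  have hnd := nodup_cons_of_mem_words hmS hT hl
  have hlT {a : α} : a ∈ l ↔ a ∈ T := mem_iff_of_mem_words hl
  have hnotMem {a : α} (ha : a ∈ S \ T) : a ∉ m :: l := fun h => by
    obtain ⟨h1, h2⟩ := Finset.mem_sdiff.mp ha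
    rcases List.mem_cons.mp h with rfl | h
    · exact hmS h1
    · exact h2 (hlT.mp h)
  have hmin_m : IsCycleMin ((m :: l).formPerm * ρ) m := by
    rintro b ⟨n, rfl⟩
    rw [zpow_apply_of_mem_cons hmS hl hρ List.mem_cons_self]
    by_cases h : ((m :: l).formPerm ^ n) m ∈ m :: l
    · rcases List.mem_cons.mp h with h | h
      · exact h.ge
      · exact (hm _ (hT (hlT.mp h))).le
    -- A point outside the word is fixed, so applying the inverse power shows that it equals `m`.
    · have h1 := zpow_apply_eq_self_of_apply_eq_self (List.formPerm_apply_of_notMem h) (-n)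
      rw [← mul_apply, ← zpow_add, neg_add_cancel, zpow_zero, one_apply] at h1
      exact h1.le
  have hmin_T {c : α} (hc : c ∈ T) : ¬ IsCycleMin ((m :: l).formPerm * ρ) c := fun h => by
    have hmem : c ∈ cycleList ((m :: l).formPerm * ρ) m := by
      rw [cycleList_formPerm_mul hmS hT hl hρ]
      exact List.mem_cons_of_mem _ (hlT.mpr hc)
    obtain ⟨i, hi, rfl⟩ := List.getElem_of_mem hmem
    refine (h m ?_).not_gt (hm _ (hT hc))
    rw [getElem_cycleList]
    exact SameCycle.symm ⟨i, by simp⟩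
  have hfilter : (insert m S).filter (IsCycleMin ((m :: l).formPerm * ρ)) =
      insert m ((S \ T).filter (IsCycleMin ρ)) := by
    rw [Finset.filter_insert, if_pos hmin_m]
    congr 1
    ext c
    simp only [Finset.mem_filter]
    constructor
    · rintro ⟨h1, h2⟩
      have hc : c ∈ S \ T := Finset.mem_sdiff.mpr ⟨h1, fun h => hmin_T h h2⟩
      exact ⟨hc, (isCycleMin_congr (zpow_apply_of_notMem_cons hmS hl hρ (hnotMem hc))).mp h2⟩
    · rintro ⟨hc, h2⟩
      exact ⟨(Finset.mem_sdiff.mp hc).1,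
        (isCycleMin_congr (zpow_apply_of_notMem_cons hmS hl hρ (hnotMem hc))).mpr h2⟩
  have hnot : m ∉ (S \ T).filter (IsCycleMin ρ) := fun h =>
    hmS (Finset.mem_sdiff.mp (Finset.mem_filter.mp h).1).1
  rw [cycleWeight, cycleWeight]
  simp only [hfilter]
  rw [Finset.prod_insert hnot, cycleList_formPerm_mul hmS hT hl hρ]
  congr 1
  refine Finset.prod_congr rfl fun c hc => congrArg g (cycleList_congr fun n => ?_)
  simpa using zpow_apply_of_notMem_cons hmS hl hρ (hnotMem (Finset.mem_filter.mp hc).1) (n : ℤ)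

theorem exists_formPerm_mul_eq (hm : m ∉ S) {σ : Equiv.Perm α} (hσ : σ ∈ permsOn (insert m S)) :
    ∃ T ⊆ S, ∃ l ∈ words T, ∃ ρ ∈ permsOn (S \ T), (m :: l).formPerm * ρ = σ := by
  obtain ⟨l, hl⟩ : ∃ l, cycleList σ m = m :: l := ⟨_, cycleList_eq_cons σ m⟩
  have hnd := nodup_cycleList σ m
  have hform {a : α} (ha : a ∈ m :: l) : (m :: l).formPerm a = σ a := by
    rw [← hl] at ha ⊢
    exact formPerm_cycleList_apply σ m ha
  have hsub {a : α} (ha : a ∈ m :: l) : a ∈ insert m S := by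
    by_contra hnot
    have hfix := mem_permsOn.mp hσ a hnot
    rw [← hl] at ha
    obtain ⟨i, hi, rfl⟩ := List.getElem_of_mem ha
    rw [getElem_cycleList] at hfix hnot
    -- A fixed point on the orbit of `m` would be `m` itself, which lies in `insert m S`.
    have h := zpow_apply_eq_self_of_apply_eq_self hfix (-(i : ℤ))
    rw [← mul_apply, ← zpow_natCast, ← zpow_add, neg_add_cancel, zpow_zero, one_apply] at h
    exact hnot (h ▸ Finset.mem_insert_self _ _)
  rw [hl, List.nodup_cons] at hnd
  refine ⟨l.toFinset, fun a ha => ?_, l, mem_words.mpr ⟨hnd.2, rfl⟩, (m :: l).formPerm⁻¹ * σ,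
    mem_permsOn.mpr fun a ha => ?_, mul_inv_cancel_left _ _⟩
  · rw [List.mem_toFinset] at ha
    rcases Finset.mem_insert.mp (hsub (List.mem_cons_of_mem m ha)) with rfl | h
    · exact absurd ha hnd.1
    · exact h
  · rw [mul_apply, inv_eq_iff_eq]
    by_cases h : a ∈ m :: l
    · exact (hform h).symm
    · rw [List.formPerm_apply_of_notMem h]
      refine mem_permsOn.mp hσ a fun hmem => ?_
      rcases Finset.mem_insert.mp hmem with rfl | h1
      · exact h List.mem_cons_self
      · refine ha (Finset.mem_sdiff.mpr ⟨h1, fun h2 => h ?_⟩)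
        exact List.mem_cons_of_mem _ (List.mem_toFinset.mp h2)

/-- Here `T` is the set of the other elements on the cycle of `m`. Written from `m`, this cycle is
`m l` for a unique word `l` on `T`, and the rest is an arbitrary permutation of `S \ T`. -/
theorem permSum_insert (g : List α → R) (hm : ∀ a ∈ S, m < a) :
    permSum g (insert m S) =
      ∑ T ∈ S.powerset, (∑ l ∈ words T, g (m :: l)) * permSum g (S \ T) := by
  have hmS : m ∉ S := fun h => (hm m h).false
  simp_rw [permSum, Finset.sum_mul_sum, ← Finset.sum_product']
  rw [Finset.sum_sigma']
  symm
  refine Finset.sum_bij (fun p _ => (m :: p.2.1).formPerm * p.2.2) ?_ ?_ ?_ ?_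
  · rintro ⟨T, l, ρ⟩ h
    simp only [Finset.mem_sigma, Finset.mem_powerset, Finset.mem_product] at h
    exact formPerm_mul_mem_permsOn h.1 h.2.1 h.2.2
  · rintro ⟨T, l, ρ⟩ h ⟨T', l', ρ'⟩ h' heq
    simp only [Finset.mem_sigma, Finset.mem_powerset, Finset.mem_product] at h h' heq
    obtain ⟨hT, hl, hρ⟩ := h
    obtain ⟨hT', hl', hρ'⟩ := h'
    have hll := cycleList_formPerm_mul hmS hT hl hρ
    rw [heq, cycleList_formPerm_mul hmS hT' hl' hρ'] at hll
    obtain rfl := (List.cons.inj hll).2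
    obtain rfl := mul_left_cancel heq
    obtain rfl := (mem_words.mp hl).2
    obtain rfl := (mem_words.mp hl').2
    rfl
  · intro σ hσ
    obtain ⟨T, hT, l, hl, ρ, hρ, h⟩ := exists_formPerm_mul_eq hmS hσ
    refine ⟨⟨T, l, ρ⟩, ?_, h⟩
    simp only [Finset.mem_sigma, Finset.mem_powerset, Finset.mem_product]
    exact ⟨hT, hl, hρ⟩
  · rintro ⟨T, l, ρ⟩ h
    simp only [Finset.mem_sigma, Finset.mem_powerset, Finset.mem_product] at h
    exact (cycleWeight_formPerm_mul g hm h.1 h.2.1 h.2.2).symm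

end Insert

theorem permSum_eq_egfCoeff [Algebra ℚ R] {j d : ℕ} {x y : R} (g : List α → R)
    (hg : ∀ m (T : Finset α), (∀ a ∈ T, m < a) →
      ∑ l ∈ words T, g (m :: l) = x * egfCoeff T.card (wordSeries j d y)) (S : Finset α) :
    permSum g S = egfCoeff S.card (powOf (denominator j d y) (-x)) := by
  induction S using Finset.strongInduction with
  | H S ih =>
  rcases S.eq_empty_or_nonempty with rfl | hne
  · rw [permSum_empty, Finset.card_empty, egfCoeff_zero_powOf_denominator]
  have hm := S.min'_mem hne
  have hlt : ∀ a ∈ S.erase (S.min' hne), S.min' hne < a := fun a ha =>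
    S.min'_lt_of_mem_erase_min' hne ha
  generalize S.min' hne = m at hm hlt
  have hss := Finset.erase_ssubset hm
  have hcard := Finset.card_erase_add_one hm
  conv_lhs => rw [← Finset.insert_erase hm]
  rw [permSum_insert g hlt, ← hcard, egfCoeff_succ_powOf_denominator,
    ← Finset.sum_powerset_apply_card fun k =>
      ((x * egfCoeff k (wordSeries j d y)) *
        egfCoeff ((S.erase m).card - k) (powOf (denominator j d y) (-x)))]
  refine Finset.sum_congr rfl fun T hT => ?_
  have hTS := Finset.mem_powerset.mp hT
  rw [hg m T fun a ha => hlt a (hTS ha), ih _ (Finset.sdiff_subset.trans_ssubset hss),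
    Finset.card_sdiff_of_subset hTS]

end Cycles

/-! ### From cycle matches to words, and assembly of the generating function. -/

section Main

variable {j n : ℕ} {τ : Equiv.Perm (Fin j)}

theorem red_eq_iff {α : Type*} [LinearOrder α] (f : Fin j → α) :
    (red f = fun i => (τ i : ℕ)) ↔ ∀ a b, f a < f b ↔ τ a < τ b := by
  constructor
  · intro h
    have hlt {a b : Fin j} (hab : f a < f b) : τ a < τ b := by
      rw [Fin.lt_def, ← congrFun h a, ← congrFun h b]
      refine Finset.card_lt_card (Finset.ssubset_iff_of_subset (fun c hc => ?_) |>.mpr ⟨a, ?_⟩)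
      · simp only [Finset.mem_filter, Finset.mem_univ, true_and] at hc ⊢
        exact hc.trans hab
      · simp [hab]
    intro a b
    refine ⟨hlt, fun hab => ?_⟩
    rcases lt_trichotomy (f a) (f b) with h1 | h1 | h1
    · exact h1
    -- Equal letters would have equal reductions, so the injectivity of `τ` forces the letters to be
    -- distinct.
    · have h2 : red f a = red f b := by simp only [red, h1]
      rw [congrFun h a, congrFun h b] at h2
      exact absurd (Fin.ext h2) hab.ne
    · exact absurd (hlt h1) hab.not_gt
  · intro h
    funext i
    rw [red]
    simp only [h]
    rw [← Fin.card_Iio (τ i)]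
    refine Finset.card_bij (fun a _ => τ a) (by simp) (fun a _ b _ h => τ.injective h)
      fun b hb => ⟨τ⁻¹ b, by simpa using hb, by simp⟩

theorem mem_cycleMinima {σ : Equiv.Perm (Fin n)} {c : Fin n} :
    c ∈ cycleMinima σ ↔ IsCycleMin σ c := by
  simp [cycleMinima, IsCycleMin]

/-- A match that wraps around contains the minimum `c` of the cycle after its first position,
contradicting that its first letter is strictly the smallest. All matches are therefore linear
factors of the cycle written from `c`. -/
theorem hasCycleMatch_iff (h0 : 0 < j) (h_first : (τ ⟨0, h0⟩ : ℕ) = 0)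
    (σ : Equiv.Perm (Fin n)) :
    HasCycleMatch τ σ ↔ ∃ c ∈ cycleMinima σ, ¬ Avoids τ (cycleList σ c) := by
  refine exists_congr fun c => and_congr_right fun hc => ?_
  rw [mem_cycleMinima] at hc
  simp only [red_eq_iff]
  constructor
  · rintro ⟨hj, r, hr, h⟩ hav
    by_cases hrj : r + j ≤ cycleLength σ c
    · refine hav _ ?_ (isMatch_ofFn.mpr h)
      have heq : (List.ofFn fun i : Fin j => (σ ^ (r + (i : ℕ))) c) =
          ((cycleList σ c).drop r).take j := by
        refine List.ext_getElem ?_ fun i h1 h2 => ?_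
        · simp only [List.length_ofFn, List.length_take, List.length_drop, length_cycleList]
          rw [cycleLength] at hrj
          omega
        · simp [getElem_cycleList]
      rw [heq]
      exact (List.take_prefix _ _).isInfix.trans (List.drop_suffix _ _).isInfix
    -- Position `cycleLength σ c - r` of the match is where the cycle returns to `c`.
    · have hlt : cycleLength σ c - r < j := by omega
      have h1 := (h ⟨0, h0⟩ ⟨cycleLength σ c - r, hlt⟩).mpr (by
        rw [Fin.lt_def, h_first, Nat.pos_iff_ne_zero, ← h_first]
        intro he
        have := τ.injective (Fin.ext he)
        simp at this
        omega)
      have h2 : (σ ^ (r + (cycleLength σ c - r))) c = c := by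
        rw [Nat.add_sub_cancel' hr.le, ← pow_mod_minimalPeriod, cycleLength, Nat.mod_self,
          pow_zero, one_apply]
      simp only [h2] at h1
      exact absurd h1 (hc _ ⟨(r + 0 : ℕ), by simp⟩).not_gt
  · intro hav
    simp only [Avoids, not_forall, not_not] at hav
    obtain ⟨w, ⟨s, t, hst⟩, hw⟩ := hav
    have hlen := congrArg List.length hst
    simp only [List.length_append, length_cycleList, hw.1] at hlen
    refine ⟨by rw [cycleLength]; omega, s.length, by rw [cycleLength]; omega, ?_⟩
    rw [← isMatch_ofFn]
    convert hw using 1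
    refine List.ext_getElem (by simp [hw.1]) fun i h1 h2 => ?_
    have h3 := getElem_cycleList σ c (s.length + i) (by rw [← hst]; simp; omega)
    simp only [← hst] at h3
    rw [List.getElem_append_left (by simp; omega), List.getElem_append_right (by omega)] at h3
    simp only [Nat.add_sub_cancel_left] at h3
    simp [h3]

variable {R : Type*} [CommRing R]

open Classical in
/-- The weight of a cycle, given as a list that starts with its smallest element. -/
def avoidingWeight {α : Type*} [LinearOrder α] (τ : Equiv.Perm (Fin j)) (x y : R) (l : List α) :
    R :=
  if Avoids τ l then x * y ^ (1 + listDes l) else 0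

theorem sum_words_avoidingWeight {α : Type*} [LinearOrder α] (x y : R) {m : α} {T : Finset α}
    (hT : ∀ a ∈ T, m < a) :
    ∑ l ∈ words T, avoidingWeight τ x y (m :: l) = x * wordSum τ y m T := by
  rw [wordSum, Finset.mul_sum]
  refine Finset.sum_congr rfl fun l hl => ?_
  rw [avoidingWeight, wordWeight,
    listDes_cons_of_forall_lt fun a ha => hT a ((mem_iff_of_mem_words hl).mp ha), mul_ite,
    mul_zero]

theorem sum_noCycleMatch (h0 : 0 < j) (h_first : (τ ⟨0, h0⟩ : ℕ) = 0) (x y : R) :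
    ∑ σ ∈ noCycleMatch τ n, x ^ cyc σ * y ^ cdes σ =
      permSum (avoidingWeight τ x y) (Finset.univ : Finset (Fin n)) := by
  classical
  have huniv : permsOn (Finset.univ : Finset (Fin n)) = Finset.univ := by
    ext σ
    simp [mem_permsOn]
  rw [permSum, huniv, noCycleMatch, Finset.sum_filter]
  refine Finset.sum_congr rfl fun σ _ => ?_
  have hmin : (Finset.univ.filter fun c => IsCycleMin σ c) = cycleMinima σ := by
    ext c
    simp [mem_cycleMinima]
  rw [cycleWeight]
  simp only [hmin, avoidingWeight]
  -- One cycle with a match makes the whole product vanish, so the product also encodes the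
  -- condition on `σ`.
  rw [Finset.prod_ite_zero, Finset.prod_mul_distrib, Finset.prod_const, Finset.prod_pow_eq_pow_sum]
  have hdes (c : Fin n) : listDes (cycleList σ c) = des (cycleWord σ c) :=
    (des_eq_listDes (cycleWord σ c)).symm
  simp only [hdes, hasCycleMatch_iff h0 h_first]
  simp only [not_exists, not_and, not_not]
  rfl

end Main

end
end CyclePattern

/-- For `τ ∈ S_j`, `j ≥ 3`, with `τ_1 = 1` and `τ_j = 2`, the series `NCM_τ(t, x, y)` is
`1 / (1 - y ∫_0^t exp ((1 - y) s - y^{des τ} s^{j-1} / (j-1)!) ds)^x`. -/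
theorem mainTheorem1 {R : Type*} [CommRing R] [Algebra ℚ R] (x y : R)
    (j : ℕ) (hj : 3 ≤ j) (τ : Equiv.Perm (Fin j))
    (h_first : (τ ⟨0, by omega⟩ : ℕ) = 0) (h_last : (τ ⟨j - 1, by omega⟩ : ℕ) = 1) :
    CyclePattern.NCM τ x y *
      CyclePattern.powOf (CyclePattern.denominator j (CyclePattern.des τ) y) x = 1 := by
  have h : CyclePattern.NCM τ x y =
      CyclePattern.powOf (CyclePattern.denominator j (CyclePattern.des τ) y) (-x) := by
    ext n
    rw [CyclePattern.NCM, PowerSeries.coeff_mk,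
      CyclePattern.sum_noCycleMatch (by omega) h_first,
      CyclePattern.permSum_eq_egfCoeff (j := j) (d := CyclePattern.des τ) (x := x) (y := y) _
        fun m T hT => by
          rw [CyclePattern.sum_words_avoidingWeight x y hT,
            CyclePattern.wordSum_eq_egfCoeff hj h_first h_last y T m hT],
      Finset.card_univ, Fintype.card_fin, CyclePattern.egfCoeff, Algebra.smul_def, ← mul_assoc,
      ← map_natCast (algebraMap ℚ R), ← map_mul, inv_mul_cancel₀ (by positivity), map_one,
      one_mul]
  rw [h]
  exact CyclePattern.powOf_neg_mul (CyclePattern.constantCoeff_denominator _ _ _) x
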